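/- Notation. $\mathcal{M}_d$ denotes the $d\times d$ complex matrices. A quantum channel is a completely positive, trace preserving linear map $\Phi:\mathcal{M}_d\to\mathcal{M}_{d_{\mathrm{out}}}$. Channels $\Phi:\mathcal{M}_d\to\mathcal{M}_{d_{\mathrm{out}}}$ and $\Phi_c:\mathcal{M}_d\to\mathcal{M}_{d_{\mathrm{env}}}$ are complementary if there is an isometry $V:\mathbb{C}^d\to\mathbb{C}^{d_{\mathrm{out}}}\otimes\mathbb{C}^{d_{\mathrm{env}}}$ with $\Phi(X)=\operatorname{Tr}_{\mathrm{env}}(VXV^\dagger)$ and $\Phi_c(X)=\operatorname{Tr}_{\mathrm{out}}(VXV^\dagger)$ for all $X\in\mathcal{M}_d$. The minimal environment dimension $d^*_{\mathrm{env}}(\Phi)$ is the least $d_{\mathrm{env}}$ for which some channel $\Phi_c:\mathcal{M}_d\to\mathcal{M}_{d_{\mathrm{env}}}$ is complementary to $\Phi$; the minimal output dimension is $d^*_{\mathrm{out}}(\Phi):=d^*_{\mathrm{env}}(\Phi_c)$ for a channel $\Phi_c$ complementary to $\Phi$ (this does not depend on the choice of $\Phi_c$). With the von Neumann entropy $S(\rho)=-\operatorname{Tr}(\rho\log\rho)$,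 the coherent information of $\Phi$ is $\mathcal{Q}^{(1)}(\Phi)=\max_\rho\,[S(\Phi(\rho))-S(\Phi_c(\rho))]$, the maximum being over all states $\rho$ (positive semi-definite matrices of unit trace), where $\Phi_c$ is any channel complementary to $\Phi$, and the quantum capacity of $\Phi$ is $\mathcal{Q}(\Phi)=\lim_{n\to\infty}\mathcal{Q}^{(1)}(\Phi^{\otimes n})/n$. The channel $\Phi$ is more capable if $\mathcal{Q}(\Phi_c)=0$ for every channel $\Phi_c$ complementary to $\Phi$. Theorem. Let $\Phi:\mathcal{M}_d\to\mathcal{M}_{d_{\mathrm{out}}}$ be a more capable quantum channel with $d^*_{\mathrm{out}}(\Phi)=2$. Then $d^*_{\mathrm{env}}(\Phi)\le 2$ and $d\le 3$. -/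

import Mathlib

open Filter Topology
open scoped ComplexOrder

noncomputable section

namespace QChannel

/-- `M_κ`: the square complex matrices with rows and columns indexed by `κ`; `M_d` is `Mat (Fin d)`,
and `M_d^{⊗n}` is `Mat (Fin n → Fin d)`. -/
abbrev Mat (κ : Type*) := Matrix κ κ ℂ

/-- A quantum state: a positive semi-definite matrix of unit trace. -/
def IsState {κ : Type*} [Fintype κ] (ρ : Mat κ) : Prop :=
  ρ.PosSemidef ∧ ρ.trace = 1

/-- The map `id_k ⊗ Φ` on `M_k ⊗ M_ι`: apply `Φ` to each of the `k × k` blocks of `X`. -/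
def amplify {ι κ : Type*} (k : ℕ) (Φ : Mat ι →ₗ[ℂ] Mat κ) (X : Mat (Fin k × ι)) :
    Mat (Fin k × κ) :=
  Matrix.of fun p q => Φ (Matrix.of fun a b => X (p.1, a) (q.1, b)) p.2 q.2

/-- Complete positivity: `id_k ⊗ Φ` preserves positive semi-definiteness for every `k`. -/
def IsCompletelyPositive {ι κ : Type*} (Φ : Mat ι →ₗ[ℂ] Mat κ) : Prop :=
  ∀ (k : ℕ) (X : Mat (Fin k × ι)), X.PosSemidef → (amplify k Φ X).PosSemidef

/-- A quantum channel: a completely positive, trace preserving linear map. -/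
structure IsChannel {ι κ : Type*} [Fintype ι] [Fintype κ] (Φ : Mat ι →ₗ[ℂ] Mat κ) : Prop where
  completelyPositive : IsCompletelyPositive Φ
  tracePreserving : ∀ X, (Φ X).trace = X.trace

/-- Partial trace over the second tensor factor (the environment). -/
def traceEnv {κ ε : Type*} [Fintype ε] (Y : Mat (κ × ε)) : Mat κ :=
  Matrix.of fun a b => ∑ e, Y (a, e) (b, e)

/-- Partial trace over the first tensor factor (the output). -/
def traceOut {κ ε : Type*} [Fintype κ] (Y : Mat (κ × ε)) : Mat ε :=
  Matrix.of fun e f => ∑ a, Y (a, e) (a, f)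

/-- `Φ` and `Ψ` are complementary: there is an isometry `V : ℂ^ι → ℂ^κ ⊗ ℂ^ε` such that
`Φ(X) = Tr_env (V X V†)` and `Ψ(X) = Tr_out (V X V†)` for all `X`. (Two such maps are
automatically quantum channels.) -/
def IsComplementary {ι κ ε : Type*} [Fintype ι] [Fintype κ] [Fintype ε] [DecidableEq ι]
    (Φ : Mat ι →ₗ[ℂ] Mat κ) (Ψ : Mat ι →ₗ[ℂ] Mat ε) : Prop :=
  ∃ V : Matrix (κ × ε) ι ℂ, V.conjTranspose * V = 1 ∧
    (∀ X, Φ X = traceEnv (V * X * V.conjTranspose)) ∧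
    (∀ X, Ψ X = traceOut (V * X * V.conjTranspose))

/-- The minimal environment dimension of `Φ`: the least `e` such that some channel
`Ψ : M_ι → M_e` is complementary to `Φ`. (By Stinespring's theorem the set is non-empty for every
quantum channel.) -/
def minEnvDim {ι κ : Type*} [Fintype ι] [Fintype κ] [DecidableEq ι]
    (Φ : Mat ι →ₗ[ℂ] Mat κ) : ℕ :=
  sInf {e : ℕ | ∃ Ψ : Mat ι →ₗ[ℂ] Mat (Fin e), IsComplementary Φ Ψ}

/-- The minimal output dimension of `Φ`: the minimal environment dimension of a complementary
channel `Ψ` of `Φ`. This number is the same for all complementary channels, so the set below is a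
singleton for every quantum channel and `sInf` returns its only element. -/
def minOutDim {ι κ : Type*} [Fintype ι] [Fintype κ] [DecidableEq ι]
    (Φ : Mat ι →ₗ[ℂ] Mat κ) : ℕ :=
  sInf {k : ℕ | ∃ (e : ℕ) (Ψ : Mat ι →ₗ[ℂ] Mat (Fin e)), IsComplementary Φ Ψ ∧ minEnvDim Ψ = k}

/-- The von Neumann entropy `S(ρ) = -Tr(ρ log ρ)`, with `log ρ` given by the functional calculus of
Hermitian matrices (and `0 log 0 = 0`). -/
def entropy {κ : Type*} [Fintype κ] [DecidableEq κ] (ρ : Mat κ) : ℝ :=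
  -(ρ * cfc Real.log ρ).trace.re

/-- The coherent information `Q⁽¹⁾(Φ)`: the maximum over all states `ρ` of
`I_c(ρ; Φ) = S(Φ(ρ)) - S(Ψ(ρ))`, where `Ψ` is complementary to `Φ`. The value `I_c(ρ; Φ)` is the same
for all complementary channels `Ψ` (on any finite-dimensional environment), and the supremum is a
maximum by compactness. -/
def coherentInfo {ι κ : Type} [Fintype ι] [Fintype κ] [DecidableEq ι] [DecidableEq κ]
    (Φ : Mat ι →ₗ[ℂ] Mat κ) : ℝ :=
  sSup {x : ℝ | ∃ (ε : Type) (_ : Fintype ε) (_ : DecidableEq ε) (Ψ : Mat ι →ₗ[ℂ] Mat ε)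
    (ρ : Mat ι), IsComplementary Φ Ψ ∧ IsState ρ ∧ x = entropy (Φ ρ) - entropy (Ψ ρ)}

/-- The tensor power `Φ^{⊗n}`: the linear map that sends the matrix unit
`E_{ij} = E_{i₁j₁} ⊗ ⋯ ⊗ E_{iₙjₙ}` to `Φ(E_{i₁j₁}) ⊗ ⋯ ⊗ Φ(E_{iₙjₙ})`. -/
def tensorPower {ι κ : Type*} [Fintype ι] [DecidableEq ι] (n : ℕ)
    (Φ : Mat ι →ₗ[ℂ] Mat κ) : Mat (Fin n → ι) →ₗ[ℂ] Mat (Fin n → κ) where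
  toFun X := Matrix.of fun a b =>
    ∑ i, ∑ j, X i j * ∏ t, Φ (Matrix.single (i t) (j t) 1) (a t) (b t)
  map_add' X Y := by
    ext a b
    simp [add_mul, Finset.sum_add_distrib]
  map_smul' c X := by
    ext a b
    simp [Finset.mul_sum, mul_assoc]

/-- `q` is the quantum capacity of `Φ`: `q = lim_{n → ∞} Q⁽¹⁾(Φ^{⊗n}) / n`. (The limit exists for
every quantum channel.) -/
def HasQuantumCapacity {ι κ : Type} [Fintype ι] [Fintype κ] [DecidableEq ι] [DecidableEq κ]
    (Φ : Mat ι →ₗ[ℂ] Mat κ) (q : ℝ) : Prop :=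
  Tendsto (fun n : ℕ => coherentInfo (tensorPower n Φ) / n) atTop (𝓝 q)

/-- `Φ` is more capable: every channel complementary to `Φ` has zero quantum capacity. -/
def MoreCapable {ι κ : Type} [Fintype ι] [Fintype κ] [DecidableEq ι]
    (Φ : Mat ι →ₗ[ℂ] Mat κ) : Prop :=
  ∀ (e : ℕ) (Ψ : Mat ι →ₗ[ℂ] Mat (Fin e)), IsComplementary Φ Ψ → HasQuantumCapacity Ψ 0

end QChannel

end

/-! Let `Ψ` be complementary to `Φ`, with a qubit complement `Ξ`, both read off one isometry `V`. On
product states, zero capacity of `Ψ` forces S(Ψ ρ) ≤ S(Ξ ρ) for every state ρ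
(`entropy_le_of_hasQuantumCapacity_zero`); nothing else about capacity is used. A unit vector ψ
becomes an e × 2 matrix M = `outMat V ψ`, with Ψ(ψψ†) = MM† and Ξ(ψψ†) = (M†M)ᵀ, which have equal
entropy.

If some M has rank 2, then Ξ(ψψ†) has full rank, so mixing in a weight t of another pure state
raises S(Ξ) by at most O(t). If the matrix N of that state leaves the column space of M, S(Ψ) gains
a term of order -t log t, a contradiction for small t (`exists_entropy_lt_entropy`). Hence `Ψ` lives
on the two-dimensional column space of M. If every M has rank at most 1, then all share a column,
and `Ψ` compresses to dimension 1, or all share a row, and `Ξ` does, against minimality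
(`common_column_or_row`).

Now V maps ℂ^d into ℂ² ⊗ ℂ², so d ≤ 4. If d = 4, V is unitary and the preimage of 1/2 ⊗ |0⟩⟨0|
violates the entropy inequality (`input_dim_le_three`). -/

noncomputable section

namespace QChannel

open Matrix

/-! ### Entropy through eigenvalues, and Klein's inequality -/

section Entropy

variable {κ ε ι : Type*} [Fintype κ] [Fintype ε] [Fintype ι] [DecidableEq κ] [DecidableEq ε]
  [DecidableEq ι]

/-- The spectral theorem for Hermitian matrices, together with the functional calculus. -/
lemma exists_unitary_diagonal {A : Mat κ} (hA : A.IsHermitian) :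
    ∃ U : Mat κ, Uᴴ * U = 1 ∧ U * Uᴴ = 1 ∧
      A = U * diagonal (fun i => (hA.eigenvalues i : ℂ)) * Uᴴ ∧
      ∀ f : ℝ → ℝ, cfc f A = U * diagonal (fun i => (f (hA.eigenvalues i) : ℂ)) * Uᴴ := by
  refine ⟨hA.eigenvectorUnitary, Unitary.coe_star_mul_self _, Unitary.coe_mul_star_self _, ?_, ?_⟩
  · conv_lhs => rw [hA.spectral_theorem, Unitary.conjStarAlgAut_apply]
    rfl
  · intro f
    rw [hA.cfc_eq, IsHermitian.cfc, Unitary.conjStarAlgAut_apply]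
    rfl

lemma entropy_eq_sum_eigenvalues {A : Mat κ} (hA : A.IsHermitian) :
    entropy A = ∑ i, Real.negMulLog (hA.eigenvalues i) := by
  obtain ⟨U, hU, -, hA', hf⟩ := exists_unitary_diagonal hA
  have h : A * cfc Real.log A =
      U * diagonal (fun i => ((hA.eigenvalues i * Real.log (hA.eigenvalues i) : ℝ) : ℂ)) * Uᴴ := by
    rw [hf]
    nth_rewrite 1 [hA']
    calc _ = U * diagonal (fun i => (hA.eigenvalues i : ℂ)) * (Uᴴ * U) *
        diagonal (fun i => (Real.log (hA.eigenvalues i) : ℂ)) * Uᴴ := by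
          simp only [Matrix.mul_assoc]
      _ = _ := by
          rw [hU, Matrix.mul_one, Matrix.mul_assoc U, diagonal_mul_diagonal]
          simp
  rw [entropy, h, trace_mul_comm, ← Matrix.mul_assoc, hU, Matrix.one_mul, trace_diagonal,
    ← Complex.ofReal_sum, Complex.ofReal_re, ← Finset.sum_neg_distrib]
  simp [Real.negMulLog]

/-- Entropy depends only on the characteristic polynomial, so the invariances below reduce to
polynomial identities. -/
lemma entropy_eq_sum_roots {A : Mat κ} (hA : A.IsHermitian) :
    entropy A = (A.charpoly.roots.map fun z => Real.negMulLog z.re).sum := by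
  rw [entropy_eq_sum_eigenvalues hA, hA.roots_charpoly_eq_eigenvalues, Multiset.map_map]
  rfl

lemma entropy_conj_diagonal {U : Mat κ} (hU : Uᴴ * U = 1) (f : κ → ℝ) :
    entropy (U * diagonal (fun i => (f i : ℂ)) * Uᴴ) = ∑ i, Real.negMulLog (f i) := by
  have hH : (U * diagonal (fun i => (f i : ℂ)) * Uᴴ).IsHermitian := by
    apply isHermitian_mul_mul_conjTranspose
    rw [isHermitian_diagonal_iff]
    intro i
    simp [IsSelfAdjoint]
  have hc : (U * diagonal (fun i => (f i : ℂ)) * Uᴴ).charpoly =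
      (diagonal (fun i => (f i : ℂ))).charpoly := by
    rw [charpoly_mul_comm, ← Matrix.mul_assoc, hU, Matrix.one_mul]
  rw [entropy_eq_sum_roots hH, hc, charpoly_diagonal, Polynomial.roots_prod]
  · simp
  · simp [Finset.prod_ne_zero_iff, Polynomial.X_sub_C_ne_zero]

lemma entropy_transpose {A : Mat κ} (hA : A.IsHermitian) : entropy Aᵀ = entropy A := by
  rw [entropy_eq_sum_roots hA, entropy_eq_sum_roots hA.transpose, charpoly_transpose]

/-- The two characteristic polynomials differ by a power of X, and the root 0 contributes nothing.
-/
lemma entropy_mul_conjTranspose (M : Matrix κ ε ℂ) : entropy (M * Mᴴ) = entropy (Mᴴ * M) := by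
  rw [entropy_eq_sum_roots (isHermitian_mul_conjTranspose_self M),
    entropy_eq_sum_roots (isHermitian_conjTranspose_mul_self M)]
  have h := congr_arg (fun p : Polynomial ℂ => (p.roots.map fun z => Real.negMulLog z.re).sum)
    (charpoly_mul_comm' M Mᴴ)
  have hX : ∀ n : ℕ, (Polynomial.X ^ n : Polynomial ℂ) ≠ 0 := fun n =>
    pow_ne_zero _ Polynomial.X_ne_zero
  rw [Polynomial.roots_mul (mul_ne_zero (hX _) (charpoly_monic _).ne_zero),
    Polynomial.roots_mul (mul_ne_zero (hX _) (charpoly_monic _).ne_zero)] at h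
  simpa [Multiset.map_nsmul, Multiset.sum_nsmul] using h

lemma entropy_fromBlocks {A : Mat κ} {B : Mat ε} (hA : A.IsHermitian) (hB : B.IsHermitian) :
    entropy (fromBlocks A 0 0 B) = entropy A + entropy B := by
  have h : (fromBlocks A 0 0 B).IsHermitian := IsHermitian.fromBlocks hA (by simp) hB
  rw [entropy_eq_sum_roots h, entropy_eq_sum_roots hA, entropy_eq_sum_roots hB,
    charpoly_fromBlocks_zero₁₂, Polynomial.roots_mul
      (mul_ne_zero (charpoly_monic _).ne_zero (charpoly_monic _).ne_zero)]
  simp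

lemma trace_re_eq_sum_eigenvalues {A : Mat κ} (hA : A.IsHermitian) :
    A.trace.re = ∑ i, hA.eigenvalues i := by
  rw [hA.trace_eq_sum_eigenvalues]
  simp

lemma entropy_smul {A : Mat κ} (hA : A.IsHermitian) (c : ℝ) :
    entropy ((c : ℂ) • A) = c * entropy A + A.trace.re * Real.negMulLog c := by
  obtain ⟨U, hU, -, hA', -⟩ := exists_unitary_diagonal hA
  have h : (c : ℂ) • A =
      U * diagonal (fun i => ((c * hA.eigenvalues i : ℝ) : ℂ)) * Uᴴ := by
    nth_rewrite 1 [hA']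
    rw [← Matrix.smul_mul, ← Matrix.mul_smul, ← diagonal_smul]
    congr! 3
    ext i
    simp
  rw [h, entropy_conj_diagonal hU, entropy_eq_sum_eigenvalues hA, trace_re_eq_sum_eigenvalues hA,
    Finset.mul_sum, Finset.sum_mul, ← Finset.sum_add_distrib]
  refine Finset.sum_congr rfl fun i _ => ?_
  rw [Real.negMulLog_mul]
  ring

lemma eigenvalues_le_one {A : Mat κ} (hA : IsState A) (i : κ) : hA.1.1.eigenvalues i ≤ 1 := by
  have h := trace_re_eq_sum_eigenvalues hA.1.1
  have h1 : A.trace.re = 1 := by rw [hA.2, Complex.one_re]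
  rw [← h1, h]
  exact Finset.single_le_sum (f := hA.1.1.eigenvalues) (fun j _ => hA.1.eigenvalues_nonneg j)
    (Finset.mem_univ i)

lemma entropy_nonneg {A : Mat κ} (hA : IsState A) : 0 ≤ entropy A := by
  rw [entropy_eq_sum_eigenvalues hA.1.1]
  exact Finset.sum_nonneg fun i _ =>
    Real.negMulLog_nonneg (hA.1.eigenvalues_nonneg i) (eigenvalues_le_one hA i)

/-- A crude bound: it only serves to make the supremum in `coherentInfo` bounded. -/
lemma entropy_le_card {A : Mat κ} (hA : A.PosSemidef) : entropy A ≤ Fintype.card κ := by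
  rw [entropy_eq_sum_eigenvalues hA.1]
  calc _ ≤ ∑ _i : κ, (1 : ℝ) := Finset.sum_le_sum fun i _ => by
        linarith [Real.negMulLog_le_one_sub_self (hA.eigenvalues_nonneg i), hA.eigenvalues_nonneg i]
    _ = _ := by simp

/-- `-Tr(X log Y)`. -/
def crossEntropy (X Y : Mat κ) : ℝ := -(X * cfc Real.log Y).trace.re

lemma crossEntropy_self (X : Mat κ) : crossEntropy X X = entropy X := rfl

lemma crossEntropy_add (X X' Y : Mat κ) :
    crossEntropy (X + X') Y = crossEntropy X Y + crossEntropy X' Y := by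
  simp [crossEntropy, Matrix.add_mul]
  ring

lemma crossEntropy_smul (c : ℝ) (X Y : Mat κ) :
    crossEntropy ((c : ℂ) • X) Y = c * crossEntropy X Y := by
  simp [crossEntropy]

lemma trace_mul_conj_diagonal (X W : Mat κ) (f : κ → ℝ) :
    (X * (W * diagonal (fun i => (f i : ℂ)) * Wᴴ)).trace.re =
      ∑ j, f j * ((Wᴴ * X * W) j j).re := by
  rw [← Matrix.mul_assoc, trace_mul_comm, ← Matrix.mul_assoc, ← Matrix.mul_assoc, trace]
  simp [diag, mul_diagonal, mul_comm]

lemma crossEntropy_nonneg {X Y : Mat κ} (hX : X.PosSemidef) (hY : IsState Y) :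
    0 ≤ crossEntropy X Y := by
  obtain ⟨W, hW, -, -, hf⟩ := exists_unitary_diagonal hY.1.1
  rw [crossEntropy, hf, trace_mul_conj_diagonal, ← Finset.sum_neg_distrib]
  refine Finset.sum_nonneg fun j _ => ?_
  have h1 := Real.log_nonpos (hY.1.eigenvalues_nonneg j) (eigenvalues_le_one hY j)
  have h2 : 0 ≤ ((Wᴴ * X * W) j j).re :=
    (Complex.le_def.1 ((hX.conjTranspose_mul_mul_same W).diag_nonneg (i := j))).1
  nlinarith

/-- Scalar Klein inequality: log u ≤ u - 1 at u = y / x. -/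
lemma mul_log_sub_ge {x y : ℝ} (hx : 0 ≤ x) (hy : 0 < y) :
    Real.negMulLog x + x - y ≤ -(x * Real.log y) := by
  rcases hx.eq_or_lt with rfl | hx
  · simp [hy.le]
  · have h := Real.log_le_sub_one_of_pos (div_pos hy hx)
    rw [Real.log_div hy.ne' hx.ne'] at h
    have h2 : x * (Real.log y - Real.log x) ≤ x * (y / x - 1) := mul_le_mul_of_nonneg_left h hx.le
    have h3 : x * (y / x - 1) = y - x := by field_simp
    simp only [Real.negMulLog]
    linarith

/-- Klein's inequality. -/
lemma entropy_add_trace_sub_le_crossEntropy {X Y : Mat κ} (hX : X.PosSemidef) (hY : Y.PosSemidef)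
    (hker : ∀ v, Y *ᵥ v = 0 → X *ᵥ v = 0) :
    entropy X + X.trace.re - Y.trace.re ≤ crossEntropy X Y := by
  obtain ⟨U, hU, hU', hXU, -⟩ := exists_unitary_diagonal hX.1
  obtain ⟨W, hW, hW', hYW, hf⟩ := exists_unitary_diagonal hY.1
  set x := hX.1.eigenvalues with hx
  set y := hY.1.eigenvalues with hy
  have hx0 : ∀ i, 0 ≤ x i := hX.eigenvalues_nonneg
  have hy0 : ∀ i, 0 ≤ y i := hY.eigenvalues_nonneg
  -- The squared moduli of the overlaps between the two eigenbases form a doubly stochastic matrix;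
  -- averaging the scalar inequality against it gives the result.
  set T : Mat κ := Uᴴ * W with hT
  have hTT : Tᴴ * T = 1 := by
    rw [hT, conjTranspose_mul, conjTranspose_conjTranspose, Matrix.mul_assoc, ← Matrix.mul_assoc U,
      hU', Matrix.one_mul, hW]
  have hTT' : T * Tᴴ = 1 := by
    rw [hT, conjTranspose_mul, conjTranspose_conjTranspose, Matrix.mul_assoc, ← Matrix.mul_assoc W,
      hW', Matrix.one_mul, hU]
  have hdiag : ∀ j, ((Wᴴ * X * W) j j) = ((∑ i, x i * Complex.normSq (T i j) : ℝ) : ℂ) := by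
    intro j
    have : Wᴴ * X * W = Tᴴ * (diagonal (fun i => (x i : ℂ)) * T) := by
      rw [hXU, hT, conjTranspose_mul, conjTranspose_conjTranspose]
      simp only [Matrix.mul_assoc]
    rw [this, mul_apply, Complex.ofReal_sum]
    refine Finset.sum_congr rfl fun i _ => ?_
    rw [diagonal_mul, conjTranspose_apply, Complex.ofReal_mul, Complex.normSq_eq_conj_mul_self]
    simp only [RCLike.star_def]
    ring
  have hcol : ∀ j, ∑ i, Complex.normSq (T i j) = 1 := by
    intro j
    have := congr_fun (congr_fun hTT j) j
    rw [mul_apply, one_apply_eq] at this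
    have h2 := congr_arg Complex.re this
    rw [Complex.re_sum] at h2
    rw [← Complex.one_re, ← h2]
    refine Finset.sum_congr rfl fun i _ => ?_
    rw [conjTranspose_apply, RCLike.star_def, ← Complex.normSq_eq_conj_mul_self, Complex.ofReal_re]
  have hrow : ∀ i, ∑ j, Complex.normSq (T i j) = 1 := by
    intro i
    have := congr_fun (congr_fun hTT' i) i
    rw [mul_apply, one_apply_eq] at this
    have h2 := congr_arg Complex.re this
    rw [Complex.re_sum] at h2
    rw [← Complex.one_re, ← h2]
    refine Finset.sum_congr rfl fun j _ => ?_
    rw [conjTranspose_apply, RCLike.star_def, Complex.mul_conj, Complex.ofReal_re]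
  -- When y j = 0 the scalar inequality is not available and `Real.log 0 = 0` is a junk value; the
  -- kernel inclusion makes these terms vanish.
  have hzero : ∀ i j, y j = 0 → x i * Complex.normSq (T i j) = 0 := by
    intro i j hj
    have h1 : Y *ᵥ (W *ᵥ Pi.single j 1) = 0 := by
      rw [hYW, mulVec_mulVec, Matrix.mul_assoc, Matrix.mul_assoc, hW, Matrix.mul_one,
        ← mulVec_mulVec]
      have : diagonal (fun i => (y i : ℂ)) *ᵥ Pi.single j 1 = 0 := by
        ext k
        rw [mulVec_diagonal]
        by_cases hk : k = j
        · subst hk; simp [hj]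
        · simp [hk]
      rw [this, mulVec_zero]
    have h2 := hker _ h1
    have h3 : ((Wᴴ * X * W) j j) = 0 := by
      have h4 : (Wᴴ * X * W) *ᵥ Pi.single j 1 = 0 := by
        rw [← mulVec_mulVec, ← mulVec_mulVec, h2, mulVec_zero]
      have := congr_fun h4 j
      simpa using this
    rw [hdiag, Complex.ofReal_eq_zero, Finset.sum_eq_zero_iff_of_nonneg] at h3
    · exact h3 i (Finset.mem_univ i)
    · intro k _
      exact mul_nonneg (hx0 k) (Complex.normSq_nonneg _)
  have hS : entropy X = ∑ j, ∑ i, Complex.normSq (T i j) * Real.negMulLog (x i) := by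
    rw [Finset.sum_comm, entropy_eq_sum_eigenvalues hX.1]
    exact Finset.sum_congr rfl fun i _ => by rw [← Finset.sum_mul, hrow, one_mul]
  have hXt : X.trace.re = ∑ j, ∑ i, Complex.normSq (T i j) * x i := by
    rw [Finset.sum_comm, trace_re_eq_sum_eigenvalues hX.1]
    exact Finset.sum_congr rfl fun i _ => by rw [← Finset.sum_mul, hrow, one_mul]
  have hYt : Y.trace.re = ∑ j, ∑ i, Complex.normSq (T i j) * y j := by
    rw [trace_re_eq_sum_eigenvalues hY.1]
    exact Finset.sum_congr rfl fun i _ => by rw [← Finset.sum_mul, hcol, one_mul]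
  rw [crossEntropy, hf, trace_mul_conj_diagonal, hS, hXt, hYt, ← Finset.sum_add_distrib,
    ← Finset.sum_sub_distrib, ← Finset.sum_neg_distrib]
  refine Finset.sum_le_sum fun j _ => ?_
  rw [hdiag, Complex.ofReal_re, ← Finset.sum_add_distrib, ← Finset.sum_sub_distrib,
    Finset.mul_sum, ← Finset.sum_neg_distrib]
  refine Finset.sum_le_sum fun i _ => ?_
  rcases (hy0 j).eq_or_lt with hj | hj
  · rcases mul_eq_zero.1 (hzero i j hj.symm) with h | h
    · simp [h, ← hj]
    · simp [h]
  · have := mul_le_mul_of_nonneg_left (mul_log_sub_ge (hx0 i) hj) (Complex.normSq_nonneg (T i j))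
    change _ ≤ -(Real.log (y j) * _)
    linarith

end Entropy

/-! ### First-order perturbation of entropy -/

section Perturbation

variable {κ ε ι : Type*} [Fintype κ] [Fintype ε] [Fintype ι] [DecidableEq κ] [DecidableEq ε]
  [DecidableEq ι]

lemma posSemidef_trace_smul_one_sub {A : Mat κ} (hA : A.PosSemidef) :
    (((A.trace.re : ℝ) : ℂ) • (1 : Mat κ) - A).PosSemidef := by
  obtain ⟨U, -, hU', hA', -⟩ := exists_unitary_diagonal hA.1
  have h : ((A.trace.re : ℝ) : ℂ) • (1 : Mat κ) - A =
      U * diagonal (fun i => ((A.trace.re - hA.1.eigenvalues i : ℝ) : ℂ)) * Uᴴ := by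
    have h1 : diagonal (fun i => ((A.trace.re - hA.1.eigenvalues i : ℝ) : ℂ)) =
        ((A.trace.re : ℝ) : ℂ) • (1 : Mat κ) - diagonal (fun i => (hA.1.eigenvalues i : ℂ)) := by
      rw [smul_one_eq_diagonal, diagonal_sub]
      simp
    rw [h1, Matrix.mul_sub, Matrix.sub_mul, ← hA', Matrix.mul_smul, Matrix.mul_one,
      Matrix.smul_mul, hU']
  rw [h]
  refine PosSemidef.mul_mul_conjTranspose_same (PosSemidef.diagonal fun i => ?_) U
  simp only [Pi.zero_apply, Complex.zero_le_real, sub_nonneg]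
  rw [trace_re_eq_sum_eigenvalues hA.1]
  exact Finset.single_le_sum (f := hA.1.eigenvalues) (fun j _ => hA.eigenvalues_nonneg j)
    (Finset.mem_univ i)

/-- The sum is CC† for C = [M L], and C†C is block diagonal by orthogonality. -/
lemma entropy_add_of_conjTranspose_mul_eq_zero (M L : Matrix κ ε ℂ) (h : Mᴴ * L = 0) :
    entropy (M * Mᴴ + L * Lᴴ) = entropy (M * Mᴴ) + entropy (L * Lᴴ) := by
  have h' : Lᴴ * M = 0 := by
    rw [← conjTranspose_conjTranspose M, ← conjTranspose_mul, h, conjTranspose_zero]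
  have h1 : M * Mᴴ + L * Lᴴ = fromCols M L * (fromCols M L)ᴴ := by
    rw [conjTranspose_fromCols_eq_fromRows_conjTranspose, fromCols_mul_fromRows]
  have h2 : (fromCols M L)ᴴ * fromCols M L = fromBlocks (Mᴴ * M) 0 0 (Lᴴ * L) := by
    rw [conjTranspose_fromCols_eq_fromRows_conjTranspose, fromRows_mul_fromCols, h, h']
  rw [h1, entropy_mul_conjTranspose, h2, entropy_fromBlocks
    (isHermitian_conjTranspose_mul_self M) (isHermitian_conjTranspose_mul_self L),
    entropy_mul_conjTranspose, entropy_mul_conjTranspose]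

lemma mulVec_eq_zero_of_le {κ : Type*} [Fintype κ] {A B : Mat κ} (hA : A.PosSemidef) (hAB : (B - A).PosSemidef)
    {v : κ → ℂ} (hv : B *ᵥ v = 0) : A *ᵥ v = 0 := by
  rw [← hA.dotProduct_mulVec_zero_iff]
  refine le_antisymm ?_ (hA.dotProduct_mulVec_nonneg v)
  have h := hAB.dotProduct_mulVec_nonneg v
  rw [sub_mulVec, hv, zero_sub, dotProduct_neg] at h
  simpa using h

/-- Trace monotonicity of `x ↦ x - x log x` on `[0, 1]`. -/
lemma entropy_add_trace_le {A B : Mat κ} (hA : A.PosSemidef) (hB : IsState B)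
    (hAB : (B - A).PosSemidef) : entropy A + A.trace.re - 1 ≤ entropy B := by
  have h1 := entropy_add_trace_sub_le_crossEntropy hA hB.1 fun v => mulVec_eq_zero_of_le hA hAB
  have h2 := crossEntropy_nonneg hAB hB
  have h3 := crossEntropy_add (B - A) A B
  rw [sub_add_cancel, crossEntropy_self] at h3
  rw [hB.2, Complex.one_re] at h1
  linarith

lemma isState_convex {κ : Type*} [Fintype κ] {A B : Mat κ} (hA : IsState A) (hB : IsState B)
    {t : ℝ} (h0 : 0 ≤ t)
    (h1 : t ≤ 1) : IsState (((1 - t : ℝ) : ℂ) • A + ((t : ℝ) : ℂ) • B) := by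
  refine ⟨(hA.1.smul ?_).add (hB.1.smul ?_), ?_⟩
  · rw [Complex.zero_le_real]; linarith
  · rwa [Complex.zero_le_real]
  · rw [trace_add, trace_smul, trace_smul, hA.2, hB.2]
    simp

/-- Mixing the full-rank `Mᴴ M` with a little of `Nᴴ N` changes the entropy linearly, whereas
leaking out of the range of `M` makes the entropy on the other side grow like `- t log t`. -/
lemma exists_entropy_lt_entropy (M N : Matrix κ ε ℂ) (hM : (M * Mᴴ).trace = 1)
    (hN : (N * Nᴴ).trace = 1) (hdet : (Mᴴ * M).det ≠ 0)
    (hMN : M * ((Mᴴ * M)⁻¹ * (Mᴴ * N)) ≠ N) :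
    ∃ t : ℝ, 0 ≤ t ∧ t ≤ 1 ∧
      entropy (((1 - t : ℝ) : ℂ) • (Mᴴ * M) + ((t : ℝ) : ℂ) • (Nᴴ * N)) <
      entropy (((1 - t : ℝ) : ℂ) • (M * Mᴴ) + ((t : ℝ) : ℂ) • (N * Nᴴ)) := by
  -- Least squares: N = M a + w with w orthogonal to the column space of M.
  set a := (Mᴴ * M)⁻¹ * (Mᴴ * N) with ha
  set w := N - M * a with hw
  have hunit : IsUnit (Mᴴ * M).det := isUnit_iff_ne_zero.2 hdet
  have hMw : Mᴴ * w = 0 := by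
    rw [hw, Matrix.mul_sub, ← Matrix.mul_assoc, ha, mul_nonsing_inv_cancel_left _ _ hunit, sub_self]
  have hw0 : w ≠ 0 := fun h => hMN (sub_eq_zero.1 h).symm
  set r := (w * wᴴ).trace.re with hr
  set k := (a * aᴴ).trace.re with hk
  have hA : IsState (M * Mᴴ) := ⟨posSemidef_self_mul_conjTranspose M, hM⟩
  have hC : IsState (N * Nᴴ) := ⟨posSemidef_self_mul_conjTranspose N, hN⟩
  have hA' : IsState (Mᴴ * M) :=
    ⟨posSemidef_conjTranspose_mul_self M, by rw [trace_mul_comm, hM]⟩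
  have hC' : IsState (Nᴴ * N) :=
    ⟨posSemidef_conjTranspose_mul_self N, by rw [trace_mul_comm, hN]⟩
  have hW := posSemidef_self_mul_conjTranspose w
  have hr0 : 0 < r := by
    have h1 := Complex.le_def.1 hW.trace_nonneg
    refine lt_of_le_of_ne h1.1 fun h => hw0 ?_
    rw [← trace_mul_conjTranspose_self_eq_zero_iff]
    exact Complex.ext h.symm h1.2.symm
  have hk0 : 0 ≤ k := (Complex.le_def.1 (posSemidef_self_mul_conjTranspose a).trace_nonneg).1
  -- Since aa† ≤ k, the term k MM† dominates (Ma)(Ma)†; the parallelogram identity for N ± Ma then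
  -- leaves half of (N + Ma)(N + Ma)†.
  have hle : ((k : ℂ) • (M * Mᴴ) + N * Nᴴ - ((1 / 2 : ℝ) : ℂ) • (w * wᴴ)).PosSemidef := by
    have h1 : (M * ((k : ℂ) • 1 - a * aᴴ) * Mᴴ).PosSemidef :=
      (posSemidef_trace_smul_one_sub
        (posSemidef_self_mul_conjTranspose a)).mul_mul_conjTranspose_same M
    have h2 : (((1 / 2 : ℝ) : ℂ) • ((N + M * a) * (N + M * a)ᴴ)).PosSemidef :=
      (posSemidef_self_mul_conjTranspose _).smul (by rw [Complex.zero_le_real]; norm_num)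
    convert h1.add h2 using 1
    rw [hw]
    simp only [Matrix.mul_sub, Matrix.sub_mul, Matrix.mul_add, Matrix.add_mul, conjTranspose_sub,
      conjTranspose_add, conjTranspose_mul, smul_add, smul_sub, Matrix.mul_smul, Matrix.smul_mul,
      Matrix.mul_one, Matrix.mul_assoc]
    push_cast
    module
  set K := crossEntropy (Nᴴ * N) (Mᴴ * M) with hK
  set SA := entropy (M * Mᴴ) with hSA
  set SW := entropy (w * wᴴ) with hSW
  -- The right-hand side is what `hlow` minus `hup` leaves after division by t, once nonnegative
  -- terms are dropped; log(t/2) → -∞ beats this constant.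
  obtain ⟨t, ht0, ht1, htk, htlog⟩ : ∃ t : ℝ, 0 < t ∧ t ≤ 1 ∧ t * (1 + k) ≤ 1 ∧
      r / 2 * Real.log (t / 2) < -(k * SA) + SW / 2 - (1 + k) - K := by
    have hlim : Tendsto (fun t : ℝ => Real.log (t / 2)) (𝓝[>] 0) atBot := by
      refine Real.tendsto_log_nhdsGT_zero.comp ?_
      refine tendsto_nhdsWithin_iff.2 ⟨?_, ?_⟩
      · have : Tendsto (fun t : ℝ => t / 2) (𝓝 0) (𝓝 (0 / 2)) := by
          exact (continuous_id.div_const 2).tendsto 0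
        rw [zero_div] at this
        exact this.mono_left nhdsWithin_le_nhds
      · filter_upwards [self_mem_nhdsWithin] with t ht
        exact half_pos (Set.mem_Ioi.1 ht)
    have e1 := hlim.eventually_lt_atBot ((-(k * SA) + SW / 2 - (1 + k) - K) / (r / 2))
    have e2 : ∀ᶠ t : ℝ in 𝓝[>] 0, t < 1 / (1 + k) :=
      nhdsWithin_le_nhds (Iio_mem_nhds (by positivity))
    obtain ⟨t, ⟨h1, h2⟩, h3⟩ := ((e1.and e2).and self_mem_nhdsWithin).exists
    have h4 : t * (1 + k) ≤ 1 := by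
      rw [lt_div_iff₀ (by positivity)] at h2
      exact h2.le
    have h3' : 0 < t := h3
    refine ⟨t, h3, by nlinarith, h4, ?_⟩
    rw [lt_div_iff₀ (by positivity)] at h1
    linarith
  refine ⟨t, ht0.le, ht1, ?_⟩
  set c := 1 - t * (1 + k) with hc
  have hc0 : 0 ≤ c := by linarith
  have hc1 : c ≤ 1 := by nlinarith
  have hB := isState_convex hA hC ht0.le ht1
  -- Klein's inequality against the invertible M†M: the bound is affine in t.
  have hup : entropy (((1 - t : ℝ) : ℂ) • (Mᴴ * M) + ((t : ℝ) : ℂ) • (Nᴴ * N)) ≤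
      (1 - t) * SA + t * K := by
    have hE := isState_convex hA' hC' ht0.le ht1
    have h := entropy_add_trace_sub_le_crossEntropy hE.1 hA'.1 fun v hv => by
      have : v = 0 := eq_zero_of_mulVec_eq_zero hdet hv
      rw [this, mulVec_zero]
    rw [hE.2, hA'.2, crossEntropy_add, crossEntropy_smul, crossEntropy_smul, crossEntropy_self,
      ← entropy_mul_conjTranspose] at h
    linarith
  -- By `hle` the mixture dominates c MM† + (t/2) ww†, an orthogonal sum whose entropy is explicit.
  have hlow : c * SA + Real.negMulLog c + (t / 2 * SW + r * Real.negMulLog (t / 2)) +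
      (c + t / 2 * r) - 1 ≤
      entropy (((1 - t : ℝ) : ℂ) • (M * Mᴴ) + ((t : ℝ) : ℂ) • (N * Nᴴ)) := by
    have hX : ((c : ℂ) • (M * Mᴴ) + ((t / 2 : ℝ) : ℂ) • (w * wᴴ)).PosSemidef :=
      (hA.1.smul (by rwa [Complex.zero_le_real])).add
        (hW.smul (by rw [Complex.zero_le_real]; positivity))
    have h := entropy_add_trace_le hX hB (by
      convert hle.smul (show (0 : ℂ) ≤ (t : ℂ) by rw [Complex.zero_le_real]; exact ht0.le) using 1
      rw [hc]
      push_cast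
      module)
    have hsq : ∀ (x : ℝ) (L : Matrix κ ε ℂ), 0 ≤ x →
        (x : ℂ) • (L * Lᴴ) = ((√x : ℝ) : ℂ) • L * (((√x : ℝ) : ℂ) • L)ᴴ := by
      intro x L hx
      rw [conjTranspose_smul, Matrix.smul_mul, Matrix.mul_smul, smul_smul, RCLike.star_def,
        Complex.conj_ofReal, ← Complex.ofReal_mul, Real.mul_self_sqrt hx]
    have hent : entropy ((c : ℂ) • (M * Mᴴ) + ((t / 2 : ℝ) : ℂ) • (w * wᴴ)) =
        c * SA + Real.negMulLog c + (t / 2 * SW + r * Real.negMulLog (t / 2)) := by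
      rw [hsq c M hc0, hsq (t / 2) w (by positivity), entropy_add_of_conjTranspose_mul_eq_zero,
        ← hsq c M hc0, ← hsq (t / 2) w (by positivity), entropy_smul hA.1.1, entropy_smul hW.1,
        hM, Complex.one_re, one_mul]
      rw [conjTranspose_smul, Matrix.smul_mul, Matrix.mul_smul, hMw, smul_zero, smul_zero]
    have htr : ((c : ℂ) • (M * Mᴴ) + ((t / 2 : ℝ) : ℂ) • (w * wᴴ)).trace.re = c + t / 2 * r := by
      rw [trace_add, trace_smul, trace_smul, hM, hr, smul_eq_mul, mul_one, smul_eq_mul,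
        Complex.add_re, Complex.ofReal_re, Complex.re_ofReal_mul]
    rwa [hent, htr] at h
  have hfc := Real.negMulLog_nonneg hc0 hc1
  have hmain := mul_lt_mul_of_pos_left htlog ht0
  have hft : r * Real.negMulLog (t / 2) = -(t * (r / 2 * Real.log (t / 2))) := by
    rw [Real.negMulLog]; ring
  have : 0 ≤ t / 2 * r := by positivity
  rw [hft] at hlow
  rw [hc] at hlow hfc
  nlinarith

end Perturbation

/-! ### Product states, and the single-letter consequence of zero capacity -/

section Capacity

section TensorPower

variable {α β γ : Type*}

/-- The tensor power `A ⊗ ⋯ ⊗ A` of a rectangular matrix. -/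
def tpow (n : ℕ) (A : Matrix α β ℂ) : Matrix (Fin n → α) (Fin n → β) ℂ :=
  Matrix.of fun a b => ∏ t, A (a t) (b t)

lemma tpow_mul [Fintype β] [DecidableEq β] (n : ℕ) (A : Matrix α β ℂ) (B : Matrix β γ ℂ) :
    tpow n (A * B) = tpow n A * tpow n B := by
  ext a c
  simp only [tpow, of_apply, mul_apply, Fintype.prod_sum, Finset.prod_mul_distrib]

lemma tpow_conjTranspose (n : ℕ) (A : Matrix α β ℂ) : tpow n Aᴴ = (tpow n A)ᴴ := by
  ext a b
  simp [tpow, conjTranspose_apply]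

lemma tpow_diagonal [DecidableEq α] (n : ℕ) (f : α → ℂ) :
    tpow n (diagonal f) = diagonal fun a => ∏ t, f (a t) := by
  ext a b
  simp only [tpow, of_apply, diagonal_apply]
  split_ifs with h
  · subst h; simp
  · obtain ⟨t, ht⟩ := Function.ne_iff.1 h
    exact Finset.prod_eq_zero (Finset.mem_univ t) (by simp [ht])

lemma tpow_one [DecidableEq α] (n : ℕ) : tpow n (1 : Mat α) = 1 := by
  rw [← diagonal_one, tpow_diagonal]
  simp

lemma trace_tpow [Fintype α] (n : ℕ) (A : Mat α) : (tpow n A).trace = A.trace ^ n := by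
  classical
  simp only [trace, diag, tpow, of_apply]
  rw [← Fintype.prod_sum (fun (_ : Fin n) a => A a a)]
  simp

lemma isState_tpow [Fintype α] [DecidableEq α] (n : ℕ) {A : Mat α} (hA : IsState A) :
    IsState (tpow n A) := by
  refine ⟨?_, by rw [trace_tpow, hA.2, one_pow]⟩
  obtain ⟨U, -, -, hA', -⟩ := exists_unitary_diagonal hA.1.1
  rw [hA', tpow_mul, tpow_mul, tpow_diagonal, tpow_conjTranspose]
  refine PosSemidef.mul_mul_conjTranspose_same (PosSemidef.diagonal fun a => ?_) _
  exact Finset.prod_nonneg fun t _ => Complex.zero_le_real.2 (hA.1.eigenvalues_nonneg _)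

/-- Additivity of Shannon entropy: the product rule for `negMulLog` leaves factors that sum to 1. -/
lemma sum_negMulLog_prod [Fintype α] (f : α → ℝ) (hf : ∑ a, f a = 1) (n : ℕ) :
    ∑ a : Fin n → α, Real.negMulLog (∏ t, f (a t)) = n * ∑ a, Real.negMulLog (f a) := by
  classical
  have hsum : ∀ m : ℕ, ∑ a : Fin m → α, ∏ t, f (a t) = 1 := fun m => by
    rw [← Fintype.prod_sum (fun (_ : Fin m) a => f a)]
    simp [hf]
  induction n with
  | zero => simp
  | succ n ih =>
    rw [← (Fin.consEquiv fun _ => α).sum_comp, Fintype.sum_prod_type]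
    simp only [Fin.consEquiv_apply, Fin.prod_univ_succ, Fin.cons_zero, Fin.cons_succ,
      Real.negMulLog_mul, Finset.sum_add_distrib, ← Finset.sum_mul, ← Finset.mul_sum, hsum, hf, ih]
    push_cast
    ring

lemma entropy_tpow [Fintype α] [DecidableEq α] (n : ℕ) {A : Mat α} (hA : IsState A) :
    entropy (tpow n A) = n * entropy A := by
  obtain ⟨U, hU, -, hA', -⟩ := exists_unitary_diagonal hA.1.1
  have h1 := trace_re_eq_sum_eigenvalues hA.1.1
  have h2 : A.trace.re = 1 := by rw [hA.2, Complex.one_re]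
  have h : tpow n A = tpow n U *
      diagonal (fun a : Fin n → α => ((∏ t, hA.1.1.eigenvalues (a t) : ℝ) : ℂ)) * (tpow n U)ᴴ := by
    nth_rewrite 1 [hA']
    rw [tpow_mul, tpow_mul, tpow_diagonal, tpow_conjTranspose]
    simp
  rw [h, entropy_conj_diagonal (by rw [← tpow_conjTranspose, ← tpow_mul, hU, tpow_one]),
    sum_negMulLog_prod _ (by rw [← h1, h2]), entropy_eq_sum_eigenvalues hA.1.1]

end TensorPower

variable {ι κ ε : Type*} [Fintype ι] [Fintype κ] [Fintype ε] [DecidableEq ι]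

lemma tensorPower_tpow {κ : Type*} (n : ℕ) (Φ : Mat ι →ₗ[ℂ] Mat κ) (ρ : Mat ι) :
    tensorPower n Φ (tpow n ρ) = tpow n (Φ ρ) := by
  ext a b
  have h : Φ ρ = ∑ i, ∑ j, ρ i j • Φ (single i j 1) := by
    conv_lhs => rw [matrix_eq_sum_single ρ]
    simp only [map_sum]
    refine Finset.sum_congr rfl fun i _ => Finset.sum_congr rfl fun j _ => ?_
    rw [← map_smul, smul_single, smul_eq_mul, mul_one]
  simp only [tensorPower, tpow, of_apply, LinearMap.coe_mk, AddHom.coe_mk, h, Matrix.sum_apply,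
    Matrix.smul_apply, smul_eq_mul, Fintype.prod_sum, Finset.prod_mul_distrib]

lemma IsComplementary.symm {Φ : Mat ι →ₗ[ℂ] Mat κ} {Ψ : Mat ι →ₗ[ℂ] Mat ε}
    (h : IsComplementary Φ Ψ) : IsComplementary Ψ Φ := by
  obtain ⟨V, hV, h1, h2⟩ := h
  have hs : ∀ X : Mat ι, V.submatrix Prod.swap id * X * (V.submatrix Prod.swap id)ᴴ =
      (V * X * Vᴴ).submatrix (Prod.swap : ε × κ → κ × ε) Prod.swap := by
    intro X
    ext p q
    simp [mul_apply]
  refine ⟨V.submatrix Prod.swap id, ?_, fun X => ?_, fun X => ?_⟩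
  · rw [← hV]
    ext i j
    simp only [mul_apply, conjTranspose_apply, submatrix_apply, id]
    exact (Equiv.prodComm ε κ).sum_comp fun p => star (V p i) * V p j
  · rw [hs, h2]
    rfl
  · rw [hs, h1]
    rfl

lemma IsComplementary.tensorPower (n : ℕ) {Φ : Mat ι →ₗ[ℂ] Mat κ} {Ψ : Mat ι →ₗ[ℂ] Mat ε}
    (h : IsComplementary Φ Ψ) :
    IsComplementary (tensorPower n Φ) (QChannel.tensorPower n Ψ) := by
  classical
  obtain ⟨V, hV, h1, h2⟩ := h
  -- Regroups the n output and n environment factors, so that V^{⊗n} is an isometry for the tensor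
  -- powers.
  let e := Equiv.arrowProdEquivProdArrow (Fin n) (fun _ => κ) (fun _ => ε)
  have key : ∀ (i j : ι) (p q : κ × ε), (V * single i j (1 : ℂ) * Vᴴ) p q = V p i * star (V q j) := by
    intro i j p q
    rw [mul_apply, Finset.sum_eq_single j]
    · simp
    · intro k _ hk
      rw [mul_single_apply_of_ne _ _ _ _ _ hk, zero_mul]
    · simp
  refine ⟨(tpow n V).submatrix e.symm id, ?_, fun X => ?_, fun X => ?_⟩
  · rw [← tpow_one, ← hV, tpow_mul, tpow_conjTranspose]
    ext i j
    simp only [mul_apply, conjTranspose_apply, submatrix_apply, id]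
    exact e.symm.sum_comp fun p => star (tpow n V p i) * tpow n V p j
  · ext a b
    simp only [QChannel.tensorPower, LinearMap.coe_mk, AddHom.coe_mk, of_apply, traceEnv, h1, key,
      Fintype.prod_sum]
    simp only [mul_apply, conjTranspose_apply, submatrix_apply, id, tpow, Finset.mul_sum,
      Finset.sum_mul, e, Equiv.arrowProdEquivProdArrow]
    rw [Finset.sum_comm]
    refine (Finset.sum_congr rfl fun j _ => Finset.sum_comm).trans ?_
    rw [Finset.sum_comm]
    refine Finset.sum_congr rfl fun f _ => Finset.sum_congr rfl fun j _ =>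
      Finset.sum_congr rfl fun i _ => ?_
    simp only [Finset.prod_mul_distrib]
    simp
    ring
  · ext a b
    simp only [QChannel.tensorPower, LinearMap.coe_mk, AddHom.coe_mk, of_apply, traceOut, h2, key,
      Fintype.prod_sum]
    simp only [mul_apply, conjTranspose_apply, submatrix_apply, id, tpow, Finset.mul_sum,
      Finset.sum_mul, e, Equiv.arrowProdEquivProdArrow]
    rw [Finset.sum_comm]
    refine (Finset.sum_congr rfl fun j _ => Finset.sum_comm).trans ?_
    rw [Finset.sum_comm]
    refine Finset.sum_congr rfl fun f _ => Finset.sum_congr rfl fun j _ =>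
      Finset.sum_congr rfl fun i _ => ?_
    simp only [Finset.prod_mul_distrib]
    simp
    ring

lemma isState_traceEnv {Y : Mat (κ × ε)} (hY : IsState Y) : IsState (traceEnv Y) := by
  have h : traceEnv Y = ∑ e, Y.submatrix (fun a => (a, e)) (fun a => (a, e)) := by
    ext a b
    simp [traceEnv, Matrix.sum_apply]
  refine ⟨?_, ?_⟩
  · rw [h]
    exact posSemidef_sum _ fun e _ => hY.1.submatrix _
  · rw [← hY.2]
    simp [trace, traceEnv, Fintype.sum_prod_type]

lemma IsComplementary.isState_map {Φ : Mat ι →ₗ[ℂ] Mat κ} {Ψ : Mat ι →ₗ[ℂ] Mat ε}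
    (h : IsComplementary Φ Ψ) {ρ : Mat ι} (hρ : IsState ρ) : IsState (Φ ρ) := by
  obtain ⟨V, hV, h1, -⟩ := h
  rw [h1]
  refine isState_traceEnv ⟨hρ.1.mul_mul_conjTranspose_same V, ?_⟩
  rw [trace_mul_comm, ← Matrix.mul_assoc, hV, Matrix.one_mul, hρ.2]

lemma le_coherentInfo {ι κ ε : Type} [Fintype ι] [Fintype κ] [Fintype ε] [DecidableEq ι]
    [DecidableEq κ] [DecidableEq ε] {Φ : Mat ι →ₗ[ℂ] Mat κ} {Ψ : Mat ι →ₗ[ℂ] Mat ε}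
    (h : IsComplementary Φ Ψ) {ρ : Mat ι} (hρ : IsState ρ) :
    entropy (Φ ρ) - entropy (Ψ ρ) ≤ coherentInfo Φ := by
  refine le_csSup ⟨Fintype.card κ, ?_⟩ ⟨ε, _, _, Ψ, ρ, h, hρ, rfl⟩
  rintro x ⟨ε', _, _, Ψ', ρ', h', hρ', rfl⟩
  linarith [entropy_le_card (h'.isState_map hρ').1, entropy_nonneg (h'.symm.isState_map hρ')]

/-- The product state ρ^{⊗n} makes every normalised coherent information at least S(Φ ρ) - S(Ψ ρ),
hence so is the limit 0. -/
lemma entropy_le_of_hasQuantumCapacity_zero {ι κ ε : Type} [Fintype ι] [Fintype κ] [Fintype ε]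
    [DecidableEq ι] [DecidableEq κ] [DecidableEq ε] {Φ : Mat ι →ₗ[ℂ] Mat κ}
    {Ψ : Mat ι →ₗ[ℂ] Mat ε} (h : IsComplementary Φ Ψ) (h0 : HasQuantumCapacity Φ 0)
    {ρ : Mat ι} (hρ : IsState ρ) : entropy (Φ ρ) ≤ entropy (Ψ ρ) := by
  refine sub_nonpos.1 (ge_of_tendsto h0 ?_)
  filter_upwards [eventually_gt_atTop 0] with n hn
  rw [le_div_iff₀ (by exact_mod_cast hn)]
  refine le_trans (le_of_eq ?_) (le_coherentInfo (h.tensorPower n) (isState_tpow n hρ))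
  rw [tensorPower_tpow, tensorPower_tpow, entropy_tpow n (h.isState_map hρ),
    entropy_tpow n (h.symm.isState_map hρ)]
  ring

end Capacity

/-! ### Shrinking the environment, and spaces of rank-one matrices -/

section Compression

section Blocks

variable {ι κ ε : Type*}

/-- The block of `V : ℂ^ι → ℂ^κ ⊗ ℂ^ε` at the output index `a`. -/
def outBlock (V : Matrix (κ × ε) ι ℂ) (a : κ) : Matrix ε ι ℂ := Matrix.of fun e i => V (a, e) i

lemma conjTranspose_mul_self_eq_sum_outBlock [Fintype κ] [Fintype ε]
    (V : Matrix (κ × ε) ι ℂ) : Vᴴ * V = ∑ a, (outBlock V a)ᴴ * outBlock V a := by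
  ext i j
  simp [mul_apply, Matrix.sum_apply, outBlock, Fintype.sum_prod_type]

variable [Fintype ι]

lemma mul_mul_conjTranspose_apply (V : Matrix (κ × ε) ι ℂ) (X : Mat ι) (p q : κ × ε) :
    (V * X * Vᴴ) p q = (outBlock V p.1 * X * (outBlock V q.1)ᴴ) p.2 q.2 := by
  simp [mul_apply, outBlock]

lemma traceEnv_eq_trace_outBlock [Fintype ε] (V : Matrix (κ × ε) ι ℂ) (X : Mat ι) (a b : κ) :
    traceEnv (V * X * Vᴴ) a b = (outBlock V a * X * (outBlock V b)ᴴ).trace := by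
  simp only [traceEnv, of_apply, mul_mul_conjTranspose_apply]
  rfl

lemma traceOut_eq_sum_outBlock [Fintype κ] (V : Matrix (κ × ε) ι ℂ) (X : Mat ι) :
    traceOut (V * X * Vᴴ) = ∑ a, outBlock V a * X * (outBlock V a)ᴴ := by
  ext e f
  simp only [traceOut, of_apply, mul_mul_conjTranspose_apply, Matrix.sum_apply]

variable [Fintype ε] [DecidableEq ε] [DecidableEq ι]

/-- `X ↦ P† Ψ(X) P`. -/
def compress {μ : Type*} (P : Matrix ε μ ℂ) (Ψ : Mat ι →ₗ[ℂ] Mat ε) : Mat ι →ₗ[ℂ] Mat μ where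
  toFun X := Pᴴ * Ψ X * P
  map_add' X Y := by rw [map_add, Matrix.mul_add, Matrix.add_mul]
  map_smul' c X := by simp

lemma IsComplementary.compress {μ : Type*} [Fintype μ] [DecidableEq μ] [Fintype κ]
    {Φ : Mat ι →ₗ[ℂ] Mat κ} {Ψ : Mat ι →ₗ[ℂ] Mat ε} (h : IsComplementary Φ Ψ)
    (P : Matrix ε μ ℂ) (hΨ : P * Pᴴ * Ψ 1 = Ψ 1) :
    IsComplementary Φ (compress P Ψ) := by
  obtain ⟨V, hV, h1, h2⟩ := h
  have hsum : Ψ 1 = ∑ a, outBlock V a * (outBlock V a)ᴴ := by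
    rw [h2, traceOut_eq_sum_outBlock]
    simp
  -- Ψ(1) is the sum of the positive terms BB† over the blocks B of V; what 1 - PP† kills in the sum
  -- it kills in each block.
  have hblock : ∀ a, P * Pᴴ * outBlock V a = outBlock V a := by
    set Q : Mat ε := 1 - P * Pᴴ with hQ
    have h3 : Q * Ψ 1 * Qᴴ = 0 := by
      rw [hQ, Matrix.sub_mul, hΨ, Matrix.one_mul, sub_self, Matrix.zero_mul]
    have h4 : ∑ a, ((Q * outBlock V a) * (Q * outBlock V a)ᴴ).trace = 0 := by
      rw [← trace_sum, ← trace_zero ε ℂ, ← h3, hsum, Matrix.mul_sum, Matrix.sum_mul]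
      simp only [conjTranspose_mul, Matrix.mul_assoc]
    intro a
    rw [Finset.sum_eq_zero_iff_of_nonneg
      fun a _ => (posSemidef_self_mul_conjTranspose _).trace_nonneg] at h4
    have h5 := trace_mul_conjTranspose_self_eq_zero_iff.1 (h4 a (Finset.mem_univ a))
    rw [hQ, Matrix.sub_mul, Matrix.one_mul, sub_eq_zero] at h5
    exact h5.symm
  let V' : Matrix (κ × μ) ι ℂ := Matrix.of fun p i => (Pᴴ * outBlock V p.1) p.2 i
  have hV' : ∀ a, outBlock V' a = Pᴴ * outBlock V a := fun a => rfl
  refine ⟨V', ?_, fun X => ?_, fun X => ?_⟩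
  · rw [conjTranspose_mul_self_eq_sum_outBlock, ← hV, conjTranspose_mul_self_eq_sum_outBlock]
    refine Finset.sum_congr rfl fun a _ => ?_
    rw [hV', conjTranspose_mul, conjTranspose_conjTranspose, Matrix.mul_assoc,
      ← Matrix.mul_assoc P, hblock]
  · ext a b
    rw [h1, traceEnv_eq_trace_outBlock, traceEnv_eq_trace_outBlock, hV', hV', conjTranspose_mul,
      conjTranspose_conjTranspose]
    conv_lhs => rw [← hblock a]
    simp only [Matrix.mul_assoc]
    rw [trace_mul_comm P]
    simp only [Matrix.mul_assoc]
  · change Pᴴ * Ψ X * P = _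
    rw [h2, traceOut_eq_sum_outBlock, traceOut_eq_sum_outBlock, Matrix.mul_sum, Matrix.sum_mul]
    refine Finset.sum_congr rfl fun a _ => ?_
    rw [hV', conjTranspose_mul, conjTranspose_conjTranspose]
    simp only [Matrix.mul_assoc]

/-- Orthonormalises the columns of G: P is G (G†G)^{-1/2} up to a unitary on the right. -/
lemma exists_isometry_mul_eq {ε μ : Type*} [Fintype ε] [Fintype μ] [DecidableEq μ] (G : Matrix ε μ ℂ)
    (hG : (Gᴴ * G).det ≠ 0) :
    ∃ (P : Matrix ε μ ℂ) (R : Mat μ), Pᴴ * P = 1 ∧ G = P * R := by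
  have hH := isHermitian_conjTranspose_mul_self G
  obtain ⟨U, hU, hU', hD, -⟩ := exists_unitary_diagonal hH
  have hpos : ∀ i, 0 < hH.eigenvalues i := by
    have h0 : ∀ i, 0 ≤ hH.eigenvalues i := (posSemidef_conjTranspose_mul_self G).eigenvalues_nonneg
    intro i
    refine lt_of_le_of_ne (h0 i) fun h => hG ?_
    rw [hH.det_eq_prod_eigenvalues]
    exact Finset.prod_eq_zero (Finset.mem_univ i) (by rw [← h]; rfl)
  set y := hH.eigenvalues with hy
  have hsq : ∀ i, ((√(y i) : ℝ) : ℂ) ≠ 0 := fun i =>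
    Complex.ofReal_ne_zero.2 (Real.sqrt_pos.2 (hpos i)).ne'
  have hsq2 : ∀ i, ((√(y i) : ℝ) : ℂ) * ((√(y i) : ℝ) : ℂ) = y i := fun i => by
    rw [← Complex.ofReal_mul, Real.mul_self_sqrt (hpos i).le]
  set S : Mat μ := diagonal fun i => ((√(y i) : ℝ) : ℂ)
  set S' : Mat μ := diagonal fun i => ((√(y i) : ℝ) : ℂ)⁻¹ with hS'
  have hSS : S' * S = 1 := by
    rw [diagonal_mul_diagonal, ← diagonal_one]
    congr! 2 with i
    exact inv_mul_cancel₀ (hsq i)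
  have hSDS : S' * diagonal (fun i => (y i : ℂ)) * S' = 1 := by
    rw [diagonal_mul_diagonal, diagonal_mul_diagonal, ← diagonal_one]
    congr! 2 with i
    rw [← hsq2 i]
    have := hsq i
    field_simp
  have hSH : S'ᴴ = S' := by
    rw [hS', diagonal_conjTranspose]
    congr! 2 with i
    simp
  refine ⟨G * (U * S'), S * Uᴴ, ?_, ?_⟩
  · calc _ = S' * (Uᴴ * (Gᴴ * G) * U) * S' := by
          rw [conjTranspose_mul, conjTranspose_mul, hSH]
          simp only [Matrix.mul_assoc]
      _ = S' * ((Uᴴ * U) * diagonal (fun i => (y i : ℂ)) * (Uᴴ * U)) * S' := by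
          rw [hD]
          simp only [Matrix.mul_assoc]
      _ = 1 := by rw [hU, Matrix.one_mul, Matrix.mul_one, hSDS]
  · calc G = G * (U * Uᴴ) := by rw [hU', Matrix.mul_one]
      _ = G * (U * (S' * S) * Uᴴ) := by rw [hSS, Matrix.mul_one]
      _ = _ := by simp only [Matrix.mul_assoc]

/-- One `Ψ'` must serve every complement of `Ψ`, since it is later paired with both `Φ` and `Ξ`. -/
lemma exists_compression {k : ℕ} (Ψ : Mat ι →ₗ[ℂ] Mat ε) (G : Matrix ε (Fin k) ℂ)
    (hG : (Gᴴ * G).det ≠ 0) (hΨ : ∃ R : Matrix (Fin k) ε ℂ, Ψ 1 = G * R) :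
    ∃ Ψ' : Mat ι →ₗ[ℂ] Mat (Fin k), ∀ (m : ℕ) (Φ : Mat ι →ₗ[ℂ] Mat (Fin m)),
      IsComplementary Φ Ψ → IsComplementary Φ Ψ' := by
  obtain ⟨P, R, hP, rfl⟩ := exists_isometry_mul_eq G hG
  obtain ⟨R', hR'⟩ := hΨ
  refine ⟨compress P Ψ, fun m Φ h => h.compress P ?_⟩
  rw [hR', ← Matrix.mul_assoc, ← Matrix.mul_assoc, Matrix.mul_assoc P, hP, Matrix.mul_one]

end Blocks

section RankOne

variable {α β : Type*}

lemma exists_eq_smul_of_mul_eq {p p' : α → ℂ} (hp : p ≠ 0)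
    (h : ∀ a b, p a * p' b = p b * p' a) : ∃ c : ℂ, p' = c • p := by
  obtain ⟨a, ha⟩ := Function.ne_iff.1 hp
  refine ⟨p' a / p a, funext fun b => ?_⟩
  have ha' : p a ≠ 0 := ha
  rw [Pi.smul_apply, smul_eq_mul, div_mul_eq_mul_div, eq_div_iff ha']
  linear_combination h a b

lemma exists_eq_vecMulVec {M : Matrix α β ℂ} (h : ∀ a b s t, M a s * M b t = M b s * M a t) :
    ∃ p r, M = vecMulVec p r := by
  by_cases hM : M = 0
  · exact ⟨0, 0, by rw [hM, zero_vecMulVec]⟩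
  · obtain ⟨a, s, has⟩ : ∃ a s, M a s ≠ 0 := by
      by_contra! h'
      exact hM (Matrix.ext h')
    refine ⟨fun b => M b s, fun t => M a t / M a s, ?_⟩
    ext b t
    rw [vecMulVec_apply, mul_div_assoc', eq_div_iff has]
    linear_combination h b a t s

/-- In a linear space of matrices of rank at most one, all matrices have the same column space or
all have the same row space. -/
lemma common_column_or_row (S : Submodule ℂ (Matrix α β ℂ))
    (hS : ∀ M ∈ S, ∀ a b s t, M a s * M b t = M b s * M a t) :
    (∃ p, ∀ M ∈ S, ∃ r, M = vecMulVec p r) ∨ (∃ r, ∀ M ∈ S, ∃ p, M = vecMulVec p r) := by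
  by_cases h0 : ∀ M ∈ S, M = 0
  · exact Or.inl ⟨0, fun M hM => ⟨0, by rw [h0 M hM, zero_vecMulVec]⟩⟩
  push Not at h0
  obtain ⟨M, hM, hM0⟩ := h0
  obtain ⟨p, r, rfl⟩ := exists_eq_vecMulVec (hS M hM)
  have hp : p ≠ 0 := by rintro rfl; exact hM0 (by ext; simp [vecMulVec_apply])
  have hr : r ≠ 0 := by rintro rfl; exact hM0 (by ext; simp [vecMulVec_apply])
  have key : ∀ N ∈ S, (∃ r', N = vecMulVec p r') ∨ (∃ p', N = vecMulVec p' r) := by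
    intro N hN
    obtain ⟨p', r', rfl⟩ := exists_eq_vecMulVec (hS N hN)
    -- A 2 × 2 minor of a sum of two rank-one matrices factors into a column minor times a row
    -- minor.
    have h : ∀ a b s t, (p a * p' b - p b * p' a) * (r s * r' t - r t * r' s) = 0 := by
      intro a b s t
      have := hS _ (S.add_mem hM hN) a b s t
      simp only [Matrix.add_apply, vecMulVec_apply] at this
      linear_combination this
    by_cases hpp : ∀ a b, p a * p' b = p b * p' a
    · obtain ⟨c, rfl⟩ := exists_eq_smul_of_mul_eq hp hpp
      exact Or.inl ⟨c • r', by rw [smul_vecMulVec, vecMulVec_smul]⟩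
    · push Not at hpp
      obtain ⟨a, b, hab⟩ := hpp
      obtain ⟨c, rfl⟩ := exists_eq_smul_of_mul_eq (p' := r') hr fun s t =>
        sub_eq_zero.1 ((mul_eq_zero.1 (h a b s t)).resolve_left (sub_ne_zero.2 hab))
      exact Or.inr ⟨c • p', by rw [smul_vecMulVec, vecMulVec_smul]⟩
  -- A linear space is not the union of two proper subspaces: N₁ + N₂ would fit neither alternative.
  by_contra! hcon
  obtain ⟨N₁, hN₁, h₁⟩ := hcon.1 p
  obtain ⟨N₂, hN₂, h₂⟩ := hcon.2 r
  obtain ⟨p₁, hp₁⟩ := (key N₁ hN₁).resolve_left fun ⟨r', h⟩ => h₁ r' h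
  obtain ⟨r₂, hr₂⟩ := (key N₂ hN₂).resolve_right fun ⟨p', h⟩ => h₂ p' h
  rcases key _ (S.add_mem hN₁ hN₂) with ⟨r', h⟩ | ⟨p', h⟩
  · exact h₁ (r' - r₂) (by rw [vecMulVec_sub, ← h, ← hr₂, add_sub_cancel_right])
  · exact h₂ (p' - p₁) (by rw [sub_vecMulVec, ← h, ← hp₁, add_sub_cancel_left])

end RankOne

end Compression

/-! ### Pure states as matrices, and the dimension bounds -/

section SmallDimension

variable {ι κ ε : Type*} [Fintype ι]

/-- The vector `V ψ ∈ ℂ^κ ⊗ ℂ^ε`, as a `κ × ε` matrix. -/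
def outMat (V : Matrix (κ × ε) ι ℂ) : (ι → ℂ) →ₗ[ℂ] Matrix κ ε ℂ where
  toFun ψ := Matrix.of fun a e => (V *ᵥ ψ) (a, e)
  map_add' x y := by
    ext
    simp [mulVec_add]
  map_smul' c x := by
    ext
    simp [mulVec_smul]

lemma traceEnv_pure [Fintype ε] (V : Matrix (κ × ε) ι ℂ) (ψ : ι → ℂ) :
    traceEnv (V * vecMulVec ψ (star ψ) * Vᴴ) = outMat V ψ * (outMat V ψ)ᴴ := by
  rw [mul_vecMulVec, vecMulVec_mul, ← star_mulVec]
  ext a b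
  simp [traceEnv, mul_apply, vecMulVec_apply, outMat]

lemma traceOut_pure [Fintype κ] (V : Matrix (κ × ε) ι ℂ) (ψ : ι → ℂ) :
    traceOut (V * vecMulVec ψ (star ψ) * Vᴴ) = ((outMat V ψ)ᴴ * outMat V ψ)ᵀ := by
  rw [mul_vecMulVec, vecMulVec_mul, ← star_mulVec]
  ext a b
  simp [traceOut, mul_apply, vecMulVec_apply, outMat, mul_comm]

lemma isState_pure {ψ : ι → ℂ} (hψ : star ψ ⬝ᵥ ψ = 1) : IsState (vecMulVec ψ (star ψ)) := by
  refine ⟨posSemidef_vecMulVec_self_star ψ, ?_⟩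
  rw [trace_vecMulVec, dotProduct_comm, hψ]

lemma exists_column [Fintype κ] [Nonempty κ] [DecidableEq κ] (p : κ → ℂ) :
    ∃ G : Matrix κ (Fin 1) ℂ, (Gᴴ * G).det ≠ 0 ∧
      ∀ r : ε → ℂ, ∃ R : Matrix (Fin 1) ε ℂ, vecMulVec p r = G * R := by
  have hdet : ∀ q : κ → ℂ, q ≠ 0 →
      ((replicateCol (Fin 1) q)ᴴ * replicateCol (Fin 1) q).det ≠ 0 := by
    intro q hq
    rw [det_fin_one]
    intro h
    exact hq (dotProduct_star_self_eq_zero.1 (by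
      simpa [mul_apply, dotProduct, mul_comm] using h))
  by_cases hp : p = 0
  -- For p = 0 any nonzero column will do; this is where κ must be nonempty.
  · refine ⟨replicateCol (Fin 1) (Pi.single (Classical.arbitrary κ) 1), hdet _ ?_, fun r => ⟨0, ?_⟩⟩
    · exact fun h => one_ne_zero (α := ℂ) (by simpa using congr_fun h (Classical.arbitrary κ))
    · rw [hp, zero_vecMulVec, Matrix.mul_zero]
  · exact ⟨replicateCol (Fin 1) p, hdet p hp, fun r =>
      ⟨replicateRow (Fin 1) r, vecMulVec_eq (Fin 1) p r⟩⟩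

variable [DecidableEq ι]

lemma traceEnv_one [Fintype ε] (V : Matrix (κ × ε) ι ℂ) :
    traceEnv (V * (1 : Mat ι) * Vᴴ) =
      ∑ j, outMat V (Pi.single j 1) * (outMat V (Pi.single j 1))ᴴ := by
  ext a b
  simp only [Matrix.mul_one, traceEnv, of_apply, mul_apply, Matrix.sum_apply, conjTranspose_apply,
    outMat, LinearMap.coe_mk, AddHom.coe_mk, mulVec_single_one, col_apply]
  exact Finset.sum_comm

lemma traceOut_one [Fintype κ] (V : Matrix (κ × ε) ι ℂ) :
    traceOut (V * (1 : Mat ι) * Vᴴ) =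
      ∑ j, (outMat V (Pi.single j 1))ᵀ * ((outMat V (Pi.single j 1))ᵀ)ᴴ := by
  ext a b
  simp only [Matrix.mul_one, traceOut, of_apply, mul_apply, Matrix.sum_apply, conjTranspose_apply,
    outMat, LinearMap.coe_mk, AddHom.coe_mk, mulVec_single_one, col_apply, transpose_apply]
  exact Finset.sum_comm

lemma exists_eq_mul_sum {ι μ ν β : Type*} [Fintype ι] [Fintype μ] [Fintype β] (G : Matrix κ μ ℂ)
    (N : ι → Matrix κ β ℂ) (L : ι → Matrix β ν ℂ)
    (h : ∀ j, ∃ R : Matrix μ β ℂ, N j = G * R) :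
    ∃ R : Matrix μ ν ℂ, ∑ j, N j * L j = G * R := by
  choose R hR using h
  refine ⟨∑ j, R j * L j, ?_⟩
  rw [Matrix.mul_sum]
  exact Finset.sum_congr rfl fun j _ => by rw [hR j, Matrix.mul_assoc]

/-- A column of the second matrix outside the column space of the first would let a mixture of the
two pure states violate `hent`. -/
lemma outMat_factor [Fintype κ] [Fintype ε] [DecidableEq κ] [DecidableEq ε]
    {Ψ : Mat ι →ₗ[ℂ] Mat κ} {Ξ : Mat ι →ₗ[ℂ] Mat ε} {V : Matrix (κ × ε) ι ℂ}
    (h : IsComplementary Ψ Ξ)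
    (h1 : ∀ X, Ψ X = traceEnv (V * X * Vᴴ)) (h2 : ∀ X, Ξ X = traceOut (V * X * Vᴴ))
    (hent : ∀ ρ, IsState ρ → entropy (Ψ ρ) ≤ entropy (Ξ ρ))
    {ψ φ : ι → ℂ} (hψ : star ψ ⬝ᵥ ψ = 1) (hφ : star φ ⬝ᵥ φ = 1)
    (hdet : ((outMat V ψ)ᴴ * outMat V ψ).det ≠ 0) :
    ∃ R : Matrix ε ε ℂ, outMat V φ = outMat V ψ * R := by
  by_contra hcon
  have htr : ∀ χ : ι → ℂ, star χ ⬝ᵥ χ = 1 → (outMat V χ * (outMat V χ)ᴴ).trace = 1 := by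
    intro χ hχ
    rw [← traceEnv_pure, ← h1]
    exact (h.isState_map (isState_pure hχ)).2
  obtain ⟨t, ht0, ht1, hlt⟩ := exists_entropy_lt_entropy (outMat V ψ) (outMat V φ) (htr ψ hψ)
    (htr φ hφ) hdet fun h' => hcon ⟨_, h'.symm⟩
  have hle := hent _ (isState_convex (isState_pure hψ) (isState_pure hφ) ht0 ht1)
  rw [map_add, map_smul, map_smul, map_add, map_smul, map_smul, h1, h1, h2, h2, traceEnv_pure,
    traceEnv_pure, traceOut_pure, traceOut_pure, ← transpose_smul, ← transpose_smul,
    ← transpose_add, entropy_transpose] at hle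
  · exact absurd hlt hle.not_gt
  · have hs : ∀ (x : ℝ) (A : Mat ε), A.IsHermitian → ((x : ℂ) • A).IsHermitian := by
      intro x A hA
      rw [IsHermitian, conjTranspose_smul, hA, RCLike.star_def, Complex.conj_ofReal]
    exact (hs _ _ (isHermitian_conjTranspose_mul_self _)).add
      (hs _ _ (isHermitian_conjTranspose_mul_self _))

lemma exists_small_environment {d e : ℕ} [NeZero e] {Ψ : Mat (Fin d) →ₗ[ℂ] Mat (Fin e)}
    {Ξ : Mat (Fin d) →ₗ[ℂ] Mat (Fin 2)} (h : IsComplementary Ψ Ξ) (hmin : minEnvDim Ψ = 2)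
    (hcap : HasQuantumCapacity Ψ 0) :
    ∃ k ≤ 2, ∃ Ψ' : Mat (Fin d) →ₗ[ℂ] Mat (Fin k), ∀ (m : ℕ) (Φ : Mat (Fin d) →ₗ[ℂ] Mat (Fin m)),
      IsComplementary Φ Ψ → IsComplementary Φ Ψ' := by
  obtain ⟨V, hV, h1, h2⟩ := id h
  have hent : ∀ ρ, IsState ρ → entropy (Ψ ρ) ≤ entropy (Ξ ρ) := fun ρ hρ =>
    entropy_le_of_hasQuantumCapacity_zero h hcap hρ
  by_cases hfull : ∃ ψ : Fin d → ℂ, star ψ ⬝ᵥ ψ = 1 ∧ ((outMat V ψ)ᴴ * outMat V ψ).det ≠ 0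
  · obtain ⟨ψ, hψ, hdet⟩ := hfull
    refine ⟨2, le_rfl, exists_compression Ψ (outMat V ψ) hdet ?_⟩
    rw [h1, traceEnv_one]
    refine exists_eq_mul_sum _ _ _ fun j => outMat_factor h h1 h2 hent hψ ?_ hdet
    simp
  · push Not at hfull
    have hminor : ∀ M ∈ LinearMap.range (outMat V), ∀ a b s t, M a s * M b t = M b s * M a t := by
      rintro _ ⟨ψ, rfl⟩
      -- `hfull` speaks of unit vectors only, so ψ is normalised; a kernel vector v makes the two
      -- columns dependent.
      obtain ⟨v, hv0, hv⟩ : ∃ v : Fin 2 → ℂ, v ≠ 0 ∧ outMat V ψ *ᵥ v = 0 := by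
        by_cases hψ0 : ψ = 0
        · exact ⟨fun _ => 1, fun h0 => one_ne_zero (congr_fun h0 0), by
            rw [hψ0, map_zero, zero_mulVec]⟩
        have hpos : 0 < star ψ ⬝ᵥ ψ := dotProduct_star_self_pos_iff.2 hψ0
        have hpos' : 0 < (star ψ ⬝ᵥ ψ).re := (Complex.lt_def.1 hpos).1
        have him : (star ψ ⬝ᵥ ψ) = (((star ψ ⬝ᵥ ψ).re : ℝ) : ℂ) :=
          Complex.ext rfl (Complex.lt_def.1 hpos).2.symm
        set n := (star ψ ⬝ᵥ ψ).re
        have hc : ((√n : ℝ) : ℂ)⁻¹ ≠ 0 :=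
          inv_ne_zero (Complex.ofReal_ne_zero.2 (Real.sqrt_pos.2 hpos').ne')
        have hunit : star (((√n : ℝ) : ℂ)⁻¹ • ψ) ⬝ᵥ (((√n : ℝ) : ℂ)⁻¹ • ψ) = 1 := by
          rw [star_smul, smul_dotProduct, dotProduct_smul, him, smul_eq_mul, smul_eq_mul,
            RCLike.star_def, map_inv₀, Complex.conj_ofReal, ← Complex.ofReal_inv,
            ← Complex.ofReal_mul, ← Complex.ofReal_mul, ← mul_assoc, ← mul_inv,
            Real.mul_self_sqrt hpos'.le, inv_mul_cancel₀ hpos'.ne', Complex.ofReal_one]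
        obtain ⟨v, hv0, hv⟩ := exists_mulVec_eq_zero_iff.2 (hfull _ hunit)
        refine ⟨v, hv0, ?_⟩
        rw [← mulVec_mulVec, ← conjTranspose_mul_self_mulVec_eq_zero] at hv
        rw [conjTranspose_mul_self_mulVec_eq_zero, mulVec_mulVec,
          conjTranspose_mul_self_mulVec_eq_zero, map_smul, smul_mulVec] at hv
        exact (smul_eq_zero.1 hv).resolve_left hc
      have hrow : ∀ a, outMat V ψ a 0 * v 0 + outMat V ψ a 1 * v 1 = 0 := fun a => by
        simpa [mulVec, dotProduct, Fin.sum_univ_two] using congr_fun hv a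
      have h01 : ∀ a b, outMat V ψ a 0 * outMat V ψ b 1 = outMat V ψ b 0 * outMat V ψ a 1 := by
        intro a b
        have ha := hrow a
        have hb := hrow b
        by_cases h0 : v 0 = 0
        · have h1 : v 1 ≠ 0 := fun h1 => hv0 (by ext i; fin_cases i <;> simp [h0, h1])
          apply mul_right_cancel₀ h1
          linear_combination outMat V ψ a 0 * hb - outMat V ψ b 0 * ha
        · apply mul_right_cancel₀ h0
          linear_combination outMat V ψ b 1 * ha - outMat V ψ a 1 * hb
      intro a b s t
      fin_cases s <;> fin_cases t
      · exact mul_comm _ _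
      · exact h01 a b
      · have := h01 b a
        simp only [Fin.zero_eta, Fin.mk_one]
        linear_combination this
      · exact mul_comm _ _
    rcases common_column_or_row _ hminor with ⟨p, hp⟩ | ⟨r, hr⟩
    · obtain ⟨G, hG, hGp⟩ := exists_column (ε := Fin 2) p
      refine ⟨1, one_le_two, exists_compression Ψ G hG ?_⟩
      rw [h1, traceEnv_one]
      refine exists_eq_mul_sum _ _ _ fun j => ?_
      obtain ⟨r, hr⟩ := hp _ ⟨Pi.single j 1, rfl⟩
      rw [hr]
      exact hGp r
    -- A common row confines `Ξ` to one dimension, so `Ψ` would have a one-dimensional environment.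
    · exfalso
      obtain ⟨G, hG, hGr⟩ := exists_column (ε := Fin e) r
      obtain ⟨Ξ', hΞ'⟩ := exists_compression Ξ G hG (by
        rw [h2, traceOut_one]
        refine exists_eq_mul_sum _ _ _ fun j => ?_
        obtain ⟨p, hp⟩ := hr _ ⟨Pi.single j 1, rfl⟩
        rw [hp, transpose_vecMulVec]
        exact hGr p)
      have : minEnvDim Ψ ≤ 1 := Nat.sInf_le ⟨Ξ', hΞ' e Ψ h⟩
      omega

lemma input_dim_le_three {d e : ℕ} (he : e ≤ 2) {Ψ : Mat (Fin d) →ₗ[ℂ] Mat (Fin e)}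
    {Ξ : Mat (Fin d) →ₗ[ℂ] Mat (Fin 2)} (h : IsComplementary Ψ Ξ)
    (hcap : HasQuantumCapacity Ψ 0) : d ≤ 3 := by
  by_contra! hd
  obtain ⟨V, hV, h1, h2⟩ := id h
  have hle : d ≤ e * 2 := by
    have h3 := rank_mul_le_right Vᴴ V
    rw [hV, rank_one, Fintype.card_fin] at h3
    simpa using h3.trans (rank_le_card_height V)
  obtain rfl : e = 2 := by omega
  obtain rfl : d = 4 := by omega
  have hV' : V * Vᴴ = 1 := (mul_eq_one_comm_of_card_eq (Fin 4) (Fin 2 × Fin 2) ℂ (by simp)).1 hV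
  -- D = 1/2 ⊗ |0⟩⟨0|: maximally mixed for `Ψ`, pure for `Ξ`, so the inequality would read log 2 ≤
  -- 0.
  set D : Mat (Fin 2 × Fin 2) := diagonal fun p => if p.2 = 0 then 1 / 2 else 0 with hD
  have hρ : V * (Vᴴ * D * V) * Vᴴ = D := by
    calc _ = (V * Vᴴ) * D * (V * Vᴴ) := by simp only [Matrix.mul_assoc]
      _ = D := by rw [hV', Matrix.one_mul, Matrix.mul_one]
  have hstate : IsState (Vᴴ * D * V) := by
    refine ⟨PosSemidef.conjTranspose_mul_mul_same (PosSemidef.diagonal fun p => ?_) V, ?_⟩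
    · simp only [Pi.zero_apply]
      split_ifs
      · rw [show (1 / 2 : ℂ) = ((1 / 2 : ℝ) : ℂ) by norm_num, Complex.zero_le_real]
        norm_num
      · exact le_rfl
    · rw [trace_mul_comm, ← Matrix.mul_assoc, hV', Matrix.one_mul, hD, trace_diagonal,
        Fintype.sum_prod_type]
      simp
  have hle := entropy_le_of_hasQuantumCapacity_zero h hcap hstate
  have hE : traceEnv D = 1 * diagonal (fun _ => ((1 / 2 : ℝ) : ℂ)) * (1 : Mat (Fin 2))ᴴ := by
    rw [Matrix.one_mul, conjTranspose_one, Matrix.mul_one]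
    ext a b
    fin_cases a <;> fin_cases b <;> simp [traceEnv, hD, diagonal_apply]
  have hO : traceOut D =
      1 * diagonal (fun s => ((if s = 0 then 1 else 0 : ℝ) : ℂ)) * (1 : Mat (Fin 2))ᴴ := by
    rw [Matrix.one_mul, conjTranspose_one, Matrix.mul_one]
    ext a b
    fin_cases a <;> fin_cases b <;> norm_num [traceOut, hD, diagonal_apply]
  rw [h1, h2, hρ, hE, hO, entropy_conj_diagonal (by simp), entropy_conj_diagonal (by simp)] at hle
  have hlog := Real.log_pos one_lt_two
  simp [Real.negMulLog] at hle
  linarith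

end SmallDimension

end QChannel

end

theorem theorem5p2 (d dout : ℕ)
    (Φ : Matrix (Fin d) (Fin d) ℂ →ₗ[ℂ] Matrix (Fin dout) (Fin dout) ℂ)
    (hΦ : QChannel.IsChannel Φ)
    (hcap : QChannel.MoreCapable Φ)
    (hout : QChannel.minOutDim Φ = 2) :
    QChannel.minEnvDim Φ ≤ 2 ∧ d ≤ 3 := by
  obtain ⟨e, Ψ, hΦΨ, hmin⟩ : 2 ∈ {k : ℕ | ∃ (e : ℕ) (Ψ : QChannel.Mat (Fin d) →ₗ[ℂ]
      QChannel.Mat (Fin e)), QChannel.IsComplementary Φ Ψ ∧ QChannel.minEnvDim Ψ = k} := by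
    rw [← hout]
    -- The infimum of the empty set is 0, so the value 2 is attained.
    exact Nat.sInf_mem (Nat.nonempty_of_pos_sInf (two_pos.trans_eq hout.symm))
  obtain ⟨Ξ, hΨΞ⟩ : 2 ∈ {k : ℕ | ∃ Ξ : QChannel.Mat (Fin d) →ₗ[ℂ] QChannel.Mat (Fin k),
      QChannel.IsComplementary Ψ Ξ} := by
    rw [← hmin]
    exact Nat.sInf_mem (Nat.nonempty_of_pos_sInf (two_pos.trans_eq hmin.symm))
  obtain ⟨k, hk, Ψ', hΨ'⟩ : ∃ k ≤ 2, ∃ Ψ' : QChannel.Mat (Fin d) →ₗ[ℂ] QChannel.Mat (Fin k),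
      ∀ (m : ℕ) (Φ : QChannel.Mat (Fin d) →ₗ[ℂ] QChannel.Mat (Fin m)),
        QChannel.IsComplementary Φ Ψ → QChannel.IsComplementary Φ Ψ' := by
    -- For e = 0 there is nothing to compress, and no column vector for `exists_column` to use.
    rcases Nat.eq_zero_or_pos e with rfl | he
    · exact ⟨0, Nat.zero_le _, Ψ, fun _ _ h => h⟩
    · have : NeZero e := ⟨he.ne'⟩
      exact QChannel.exists_small_environment hΨΞ hmin (hcap e Ψ hΦΨ)
  have hmem : k ∈ {e : ℕ | ∃ Ψ : QChannel.Mat (Fin d) →ₗ[ℂ] QChannel.Mat (Fin e),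
      QChannel.IsComplementary Φ Ψ} := ⟨Ψ', hΨ' dout Φ hΦΨ⟩
  exact ⟨(Nat.sInf_le hmem).trans hk,
    QChannel.input_dim_le_three hk (hΨ' 2 Ξ hΨΞ.symm).symm (hcap k Ψ' (hΨ' dout Φ hΦΨ))⟩
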